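/- Let $\beta\in(0,1)$ and let $\{S_\beta(t)\}_{t\ge 0}$ be a $\beta$-stable subordinator, i.e. a Lévy process with non-decreasing paths and $\mathbb E[e^{-uS_\beta(t)}]=e^{-tu^\beta}$ for $u>0$. Let $W_\beta(t)=\inf\{r\ge 0: S_\beta(r)>t\}$ be its inverse. Let $k\ge 1$, let $\lambda_1,\dots,\lambda_k>0$, and put $m=\sum_{i=1}^k i\lambda_i$. Let $\Lambda:[0,\infty)\to[0,\infty)$ be right-continuous and non-decreasing with $\Lambda(0)=0$, $\Lambda(\infty)=\infty$ and $\Lambda(t)-\Lambda(t-)\le 1$ for all $t$. Let $\{N_\Lambda(t)\}_{t\ge 0}$ be a non-homogeneous generalized counting process with rates $\lambda_1,\dots,\lambda_k$ and cumulative intensity (mean function) $\Lambda$: a process with values in $\{0,1,2,\dots\}$ and non-decreasing right-continuous paths, with $N_\Lambda(0)=0$ and independent increments, such that for $s\le t$ the increment $N_\Lambda(t)-N_\Lambda(s)$ has the law of $\sum_{i=1}^k iY_i$, where $Y_1,\dots,Y_k$ are independent and $Y_i$ is Poisson with mean $\lambda_i(\Lambda(t)-\Lambda(s))/m$. (For $\Lambda(t)=mt$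 this is the generalized counting process with jumps of size $i$ at rate $\lambda_i$, $1\le i\le k$.) Put $N_\Lambda^\beta(t)=N_\Lambda(W_\beta(t))$. Let $X_1,X_2,\dots$ be i.i.d. integrable random variables with mean $\eta>0$. Assume that the sequence $(X_j)$, the process $N_\Lambda$ and the process $W_\beta$ are mutually independent, and that $\mathbb E[\Lambda(W_\beta(t))]<\infty$ for all $t\ge 0$. For $\nu>0$ and $\rho\in\mathbb R$ define $$\hat R^\beta(t)=\nu+\eta(1+\rho)\Lambda(W_\beta(t))-\sum_{j=1}^{N_\Lambda^\beta(t)}X_j,\qquad t\ge 0.$$ Put $$\mathcal F_t=\sigma\big(N_\Lambda^\beta(s),\,s\le t\big)\vee\sigma\big(W_\beta(s),\,s\ge 0\big),\qquad \mathcal G_t=\mathcal F_t\vee\sigma\Big(\sum_{j=1}^{N_\Lambda^\beta(s)}X_j,\ s\le t\Big).$$ Then $\{\hat R^\beta(t)\}_{t\ge 0}$ is a martingale if $\rho=0$, a submartingale if $\rho>0$, and a supermartingale if $\rho<0$, with respect to $(\mathcal G_t)_{t\ge 0}$. With respect to $(\mathcal F_t)_{t\ge 0}$, to which $\hat R^\beta$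 need not be adapted, for all $0\le s\le t$ the conditional expectation $\mathbb E[\hat R^\beta(t)-\hat R^\beta(s)\mid\mathcal F_s]$ is almost surely $=0$ if $\rho=0$, $\ge 0$ if $\rho>0$, and $\le 0$ if $\rho<0$. -/

import Mathlib

open MeasureTheory ProbabilityTheory Filter Set
open scoped NNReal Topology

noncomputable section

namespace RiskProcess

variable {Ω : Type*} {mΩ : MeasurableSpace Ω}

/-! ### Stable subordinator and its inverse -/

/-- `S` is a `β`-stable subordinator under `μ`: a Lévy process with non-decreasing
right-continuous paths and Laplace transform `E[exp (-u S(t))] = exp (-t u ^ β)`.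
(Left limits exist automatically since the paths are monotone.) -/
structure IsStableSubordinator (β : ℝ) (S : ℝ≥0 → Ω → ℝ) (μ : Measure Ω) : Prop where
  measurable : ∀ t, Measurable (S t)
  zero : ∀ ω, S 0 ω = 0
  mono : ∀ ω, Monotone fun t => S t ω
  rightCont : ∀ ω t, ContinuousWithinAt (fun s => S s ω) (Ici t) t
  indepIncrements : HasIndepIncrements S μ
  stationaryIncrements :
    ∀ s h : ℝ≥0, IdentDistrib (fun ω => S (s + h) ω - S s ω) (S h) μ μ
  laplace : ∀ (t : ℝ≥0) (u : ℝ), 0 < u →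
    ∫ ω, Real.exp (-u * S t ω) ∂μ = Real.exp (-(t : ℝ) * u ^ β)

/-- The first-passage time process `W(t) = inf {r ≥ 0 : S(r) > t}` of `S`. -/
def inverse (S : ℝ≥0 → Ω → ℝ) (t : ℝ≥0) (ω : Ω) : ℝ≥0 :=
  sInf {r : ℝ≥0 | (t : ℝ) < S r ω}

/-! ### The non-homogeneous generalized counting process -/

/-- The one-dimensional law at time `τ` of the (homogeneous) generalized counting process which
makes jumps of amplitude `1, …, k` at rates `lam 0, …, lam (k - 1)`: the law of
`∑ j, (j + 1) * Y j` with independent `Y j ∼ Poisson (lam j * τ)`. -/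
def gcpLaw {k : ℕ} (lam : Fin k → ℝ≥0) (τ : ℝ≥0) : Measure ℕ :=
  (Measure.pi fun j => poissonMeasure (lam j * τ)).map
    fun y : Fin k → ℕ => ∑ j : Fin k, ((j : ℕ) + 1) * y j

/-- The mean `∑ i λ_i` of the generalized counting process at time one. -/
def meanRate {k : ℕ} (lam : Fin k → ℝ≥0) : ℝ≥0 :=
  ∑ j : Fin k, (((j : ℕ) : ℝ≥0) + 1) * lam j

/-- The standing assumptions on the cumulative intensity `Λ`. -/
structure IsCumulativeIntensity (Λ : ℝ≥0 → ℝ≥0) : Prop where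
  zero : Λ 0 = 0
  mono : Monotone Λ
  rightCont : ∀ t, ContinuousWithinAt Λ (Ici t) t
  tendsto : Tendsto Λ atTop atTop
  jump_le : ∀ t, ((Λ t : ℝ≥0) : ℝ) - ((Function.leftLim Λ t : ℝ≥0) : ℝ) ≤ 1

/-- `N` is, under `μ`, a non-homogeneous generalized counting process with rates `lam` and
cumulative intensity (mean function) `Λ`: a counting process with independent increments, whose
increment over `(s, t]` is distributed as the generalized counting process with rates `lam` at the
operational time `(Λ t - Λ s) / ∑ i λ_i`.  If `Λ t = t * ∑ i λ_i` this is the generalized counting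
process itself.  (Subtraction on `ℕ` and `ℝ≥0` is harmless, as everything is monotone.) -/
structure IsNonhomogeneousGCP {k : ℕ} (lam : Fin k → ℝ≥0) (Λ : ℝ≥0 → ℝ≥0)
    (N : ℝ≥0 → Ω → ℕ) (μ : Measure Ω) : Prop where
  measurable : ∀ t, Measurable (N t)
  zero : ∀ ω, N 0 ω = 0
  mono : ∀ ω, Monotone fun t => N t ω
  rightCont : ∀ ω t, ContinuousWithinAt (fun s => N s ω) (Ici t) t
  indepIncrements : HasIndepIncrements N μ
  law_increment : ∀ s t : ℝ≥0, s ≤ t →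
    HasLaw (fun ω => N t ω - N s ω) (gcpLaw lam ((Λ t - Λ s) / meanRate lam)) μ

/-! ### Time change, aggregate claims and the risk process -/

/-- The time-changed counting process `N(W(t))`. -/
def timeChange (N : ℝ≥0 → Ω → ℕ) (W : ℝ≥0 → Ω → ℝ≥0) (t : ℝ≥0) (ω : Ω) : ℕ :=
  N (W t ω) ω

/-- The aggregate claims `∑_{j = 1}^{M(t)} X_j`; the claims are numbered from `0` in Lean. -/
def aggregateClaims (M : ℝ≥0 → Ω → ℕ) (X : ℕ → Ω → ℝ) (t : ℝ≥0) (ω : Ω) : ℝ :=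
  ∑ j ∈ Finset.range (M t ω), X j ω

/-- The risk process `ν + η (1 + ρ) Λ(W(t)) - ∑_{j = 1}^{N(W(t))} X_j`. -/
def riskProcess (ν η ρ : ℝ) (Λ : ℝ≥0 → ℝ≥0) (N : ℝ≥0 → Ω → ℕ) (W : ℝ≥0 → Ω → ℝ≥0)
    (X : ℕ → Ω → ℝ) (t : ℝ≥0) (ω : Ω) : ℝ :=
  ν + η * (1 + ρ) * (Λ (W t ω) : ℝ) - aggregateClaims (timeChange N W) X t ω

/-! ### Measurability, needed to form the filtrations -/

theorem measurable_inverse {S : ℝ≥0 → Ω → ℝ} (hm : ∀ t, Measurable (S t))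
    (hmono : ∀ ω, Monotone fun t => S t ω) (t : ℝ≥0) : Measurable (inverse S t) := by
  refine measurable_of_Iio fun a => ?_
  have key : inverse S t ⁻¹' Iio a =
      (⋃ q : ℚ, {ω | Real.toNNReal q < a ∧ (t : ℝ) < S (Real.toNNReal q) ω}) ∪
        {ω | (∀ n : ℕ, S (n : ℝ≥0) ω ≤ t) ∧ 0 < a} := by
    ext ω
    simp only [mem_preimage, mem_Iio, mem_union, mem_iUnion, mem_ofPred_eq]
    constructor
    · intro h
      by_cases hne : {r : ℝ≥0 | (t : ℝ) < S r ω}.Nonempty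
      · left
        obtain ⟨r, hr, hra⟩ := exists_lt_of_csInf_lt hne h
        obtain ⟨q, -, hrq, hqa⟩ := (NNReal.lt_iff_exists_rat_btwn _ _).mp hra
        exact ⟨q, hqa, lt_of_lt_of_le hr (hmono ω hrq.le)⟩
      · right
        refine ⟨fun n => ?_, lt_of_le_of_lt (zero_le) h⟩
        by_contra hn
        exact hne ⟨n, not_le.mp hn⟩
    · rintro (⟨q, hqa, hq⟩ | ⟨hn, ha⟩)
      · exact lt_of_le_of_lt (csInf_le (OrderBot.bddBelow _) hq) hqa
      · have hemp : {r : ℝ≥0 | (t : ℝ) < S r ω} = ∅ := by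
          refine eq_empty_of_forall_notMem fun r hr => ?_
          obtain ⟨n, hrn⟩ := exists_nat_ge r
          exact absurd (lt_of_lt_of_le hr (hmono ω hrn)) (not_lt.mpr (hn n))
        simpa [inverse, hemp] using ha
  rw [key]
  refine (MeasurableSet.iUnion fun q => ?_).union ?_
  · exact (MeasurableSet.const _).inter (measurableSet_lt measurable_const (hm _))
  · refine MeasurableSet.inter ?_ (MeasurableSet.const _)
    have : {ω | ∀ n : ℕ, S (n : ℝ≥0) ω ≤ t} = ⋂ n : ℕ, {ω | S (n : ℝ≥0) ω ≤ t} := by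
      ext ω; simp
    change MeasurableSet {ω | ∀ n : ℕ, S (n : ℝ≥0) ω ≤ t}
    rw [this]
    exact MeasurableSet.iInter fun n => measurableSet_le (hm _) measurable_const

theorem exists_approx_from_right : ∃ c : ℕ → ℝ≥0 → ℕ, (∀ n, Measurable (c n)) ∧
    ∀ x : ℝ≥0, Tendsto (fun n : ℕ => (c n x : ℝ≥0) / ((n : ℝ≥0) + 1)) atTop (𝓝[≥] x) := by
  refine ⟨fun n x => ⌊((n : ℝ≥0) + 1) * x⌋₊ + 1, fun n => ?_, fun x => ?_⟩
  · exact (Nat.measurable_floor.comp (measurable_id.const_mul _)).add_const 1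
  have hle : ∀ n : ℕ, x ≤ ((⌊((n : ℝ≥0) + 1) * x⌋₊ + 1 : ℕ) : ℝ≥0) / ((n : ℝ≥0) + 1) := by
    intro n
    have hp : (0 : ℝ≥0) < (n : ℝ≥0) + 1 := by positivity
    rw [le_div_iff₀ hp, mul_comm]
    exact_mod_cast (Nat.lt_floor_add_one (((n : ℝ≥0) + 1) * x)).le
  refine tendsto_nhdsWithin_iff.mpr ⟨?_, Eventually.of_forall hle⟩
  refine tendsto_of_tendsto_of_tendsto_of_le_of_le (g := fun _ => x)
    (h := fun n : ℕ => x + 1 / ((n : ℝ≥0) + 1)) tendsto_const_nhds ?_ hle ?_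
  · have h1 : Tendsto (fun n : ℕ => 1 / ((n : ℝ≥0) + 1)) atTop (𝓝 0) :=
      tendsto_one_div_add_atTop_nhds_zero_nat (𝕜 := ℝ≥0)
    simpa using h1.const_add x
  · intro n
    have hp : (0 : ℝ≥0) < (n : ℝ≥0) + 1 := by positivity
    have h0 : (⌊((n : ℝ≥0) + 1) * x⌋₊ : ℝ≥0) ≤ ((n : ℝ≥0) + 1) * x := Nat.floor_le zero_le
    change ((⌊((n : ℝ≥0) + 1) * x⌋₊ + 1 : ℕ) : ℝ≥0) / ((n : ℝ≥0) + 1) ≤ x + 1 / ((n : ℝ≥0) + 1)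
    rw [div_le_iff₀ hp]
    calc ((⌊((n : ℝ≥0) + 1) * x⌋₊ + 1 : ℕ) : ℝ≥0) ≤ ((n : ℝ≥0) + 1) * x + 1 := by
          rw [Nat.cast_add, Nat.cast_one]
          exact add_le_add_left h0 1
      _ = (x + 1 / ((n : ℝ≥0) + 1)) * ((n : ℝ≥0) + 1) := by field_simp

theorem measurable_timeChange {N : ℝ≥0 → Ω → ℕ} {W : ℝ≥0 → Ω → ℝ≥0}
    (hN : ∀ t, Measurable (N t))
    (hr : ∀ ω t, ContinuousWithinAt (fun s => N s ω) (Ici t) t)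
    (hW : ∀ t, Measurable (W t)) (t : ℝ≥0) : Measurable (timeChange N W t) := by
  obtain ⟨c, hc, hlim⟩ := exists_approx_from_right
  refine measurable_of_tendsto_metrizable
    (f := fun (n : ℕ) ω => N ((c n (W t ω) : ℝ≥0) / ((n : ℝ≥0) + 1)) ω) (fun n => ?_)
    (tendsto_pi_nhds.mpr fun ω => (hr ω (W t ω)).tendsto.comp (hlim (W t ω)))
  have h1 : Measurable fun p : ℕ × Ω => N ((p.1 : ℝ≥0) / ((n : ℝ≥0) + 1)) p.2 :=
    measurable_from_prod_countable_right fun m => hN ((m : ℝ≥0) / ((n : ℝ≥0) + 1))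
  exact h1.comp (((hc n).comp (hW t)).prodMk measurable_id)

theorem measurable_aggregateClaims {M : ℝ≥0 → Ω → ℕ} {X : ℕ → Ω → ℝ}
    (hM : ∀ t, Measurable (M t)) (hX : ∀ j, Measurable (X j)) (t : ℝ≥0) :
    Measurable (aggregateClaims M X t) := by
  have h1 : Measurable fun p : ℕ × Ω => ∑ j ∈ Finset.range p.1, X j p.2 :=
    measurable_from_prod_countable_right fun m =>
      Finset.measurable_fun_sum (Finset.range m) fun j _ => hX j
  exact h1.comp ((hM t).prodMk measurable_id)

theorem IsStableSubordinator.measurable_inverse {β : ℝ} {S : ℝ≥0 → Ω → ℝ} {μ : Measure Ω}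
    (hS : IsStableSubordinator β S μ) (t : ℝ≥0) : Measurable (inverse S t) :=
  RiskProcess.measurable_inverse hS.measurable hS.mono t

theorem IsNonhomogeneousGCP.measurable_timeChange {k : ℕ} {lam : Fin k → ℝ≥0} {Λ : ℝ≥0 → ℝ≥0}
    {N : ℝ≥0 → Ω → ℕ} {μ : Measure Ω} (hN : IsNonhomogeneousGCP lam Λ N μ)
    {W : ℝ≥0 → Ω → ℝ≥0} (hW : ∀ t, Measurable (W t)) (t : ℝ≥0) :
    Measurable (timeChange N W t) :=
  RiskProcess.measurable_timeChange hN.measurable hN.rightCont hW t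

/-! ### Filtrations -/

/-- The filtration `F t = σ(M s, s ≤ t) ∨ σ(W s, s ≥ 0)`. -/
def timeChangedFiltration (M : ℝ≥0 → Ω → ℕ) (W : ℝ≥0 → Ω → ℝ≥0)
    (hM : ∀ t, Measurable (M t)) (hW : ∀ t, Measurable (W t)) : Filtration ℝ≥0 mΩ where
  seq t := (⨆ s ≤ t, MeasurableSpace.comap (M s) inferInstance) ⊔
    ⨆ s, MeasurableSpace.comap (W s) inferInstance
  mono' _ _ hst := sup_le_sup_right
    (biSup_mono fun _ h => h.trans hst) _
  le' _ := sup_le (iSup₂_le fun s _ => (hM s).comap_le) (iSup_le fun s => (hW s).comap_le)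

/-- The filtration `G t = F t ∨ σ(C s, s ≤ t)` obtained from a filtration `F` by adding the
observation of a real process `C`. -/
def enlarge (F : Filtration ℝ≥0 mΩ) (C : ℝ≥0 → Ω → ℝ) (hC : ∀ t, Measurable (C t)) :
    Filtration ℝ≥0 mΩ where
  seq t := F t ⊔ ⨆ s ≤ t, MeasurableSpace.comap (C s) inferInstance
  mono' _ _ hst := sup_le_sup (F.mono hst) (biSup_mono fun _ h => h.trans hst)
  le' t := sup_le (F.le t) (iSup₂_le fun s _ => (hC s).comap_le)

end RiskProcess

end

namespace RiskProcess

/-! ### Fubini for set integrals -/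

/-! Write `C` for the aggregate claims and `L t = Λ (W t)`. Everything rests on one identity: for `s
≤ t` and every event `D` of `G s`, the integral of `C t - C s` over `D` equals that of `η * (L t - L
s)` (`setIntegral_prodClaims_sub`). The whole path of `W` is known at time `0`, so the increment of
the risk process has conditional mean `η * ρ * (L t - L s)`, whose sign is that of `ρ` because `W`
is almost surely non-decreasing. Since `F s ⊆ G s`, the same identity serves both filtrations.

By independence the triple (claims, counting path, time change) lives on a product space, where
Fubini replaces conditioning. With the counting path and `W` frozen, a section of `D` involves only
the first `N (W s)` claims, so each later claim contributes its mean `η`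
(`setIntegral_sum_range_sub`). With the claims and `W` frozen, a section of `D` involves only `N q`
for `q ≤ W s`, so the later increment contributes `Λ (W t) - Λ (W s)`
(`IsNonhomogeneousGCP.setIntegral_sub`).

Both steps need `W` monotone. The infimum of the empty set is `0`, so this can fail where `S` is
bounded; the Laplace transform shows that this is a null event. -/

theorem setIntegral_prod_congr_of_sections {A B : Type*} [MeasurableSpace A] [MeasurableSpace B]
    {P : Measure A} {Q : Measure B} [SFinite P] [SFinite Q] {f g : A × B → ℝ}
    (hf : Integrable f (P.prod Q)) (hg : Integrable g (P.prod Q)) {D : Set (A × B)}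
    (hD : MeasurableSet D)
    (h : ∀ᵐ a ∂P, ∫ b in Prod.mk a ⁻¹' D, f (a, b) ∂Q = ∫ b in Prod.mk a ⁻¹' D, g (a, b) ∂Q) :
    ∫ z in D, f z ∂(P.prod Q) = ∫ z in D, g z ∂(P.prod Q) := by
  rw [← integral_indicator hD, ← integral_indicator hD, integral_prod _ (hf.indicator hD),
    integral_prod _ (hg.indicator hD)]
  refine integral_congr_ae (h.mono fun a ha => ?_)
  have hm : MeasurableSet (Prod.mk a ⁻¹' D) := measurable_prodMk_left hD
  rw [← integral_indicator hm, ← integral_indicator hm] at ha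
  exact ha

theorem setIntegral_prod_congr_of_sections' {A B : Type*} [MeasurableSpace A] [MeasurableSpace B]
    {P : Measure A} {Q : Measure B} [SFinite P] [SFinite Q] {f g : A × B → ℝ}
    (hf : Integrable f (P.prod Q)) (hg : Integrable g (P.prod Q)) {D : Set (A × B)}
    (hD : MeasurableSet D)
    (h : ∀ᵐ b ∂Q, ∫ a in (fun a => (a, b)) ⁻¹' D, f (a, b) ∂P =
      ∫ a in (fun a => (a, b)) ⁻¹' D, g (a, b) ∂P) :
    ∫ z in D, f z ∂(P.prod Q) = ∫ z in D, g z ∂(P.prod Q) := by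
  rw [← integral_indicator hD, ← integral_indicator hD, integral_prod_symm _ (hf.indicator hD),
    integral_prod_symm _ (hg.indicator hD)]
  refine integral_congr_ae (h.mono fun b hb => ?_)
  have hm : MeasurableSet ((fun a => (a, b)) ⁻¹' D) := measurable_prodMk_right hD
  rw [← integral_indicator hm, ← integral_indicator hm] at hb
  exact hb

/-! ### Claims at deterministic counts -/

section Claims

variable {A : Type*} [MeasurableSpace A] {P : Measure A}
  {X : ℕ → A → ℝ}

/-- Each claim of index at least `m` is independent of the first `m` claims, hence of `D`, and
contributes `P(D) η`. -/
theorem setIntegral_sum_range_sub (hX : ∀ j, Measurable (X j)) (hXindep : iIndepFun X P)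
    (hXint : ∀ j, Integrable (X j) P) {η : ℝ} (hmean : ∀ j, ∫ a, X j a ∂P = η)
    {m m' : ℕ} (hm : m ≤ m') {D : Set A}
    (hD : MeasurableSet[⨆ j < m, MeasurableSpace.comap (X j) inferInstance] D) :
    ∫ a in D, (∑ j ∈ Finset.range m', X j a - ∑ j ∈ Finset.range m, X j a) ∂P =
      ∫ _ in D, η * ((m' : ℝ) - m) ∂P := by
  have hle : (⨆ j < m, MeasurableSpace.comap (X j) inferInstance) ≤
      (inferInstance : MeasurableSpace A) := iSup₂_le fun j _ => (hX j).comap_le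
  have hsum : ∀ a, ∑ j ∈ Finset.range m', X j a - ∑ j ∈ Finset.range m, X j a =
      ∑ j ∈ Finset.Ico m m', X j a := fun a => (Finset.sum_Ico_eq_sub _ hm).symm
  simp_rw [hsum]
  rw [integral_finsetSum _ fun j _ => (hXint j).integrableOn]
  have hj : ∀ j ∈ Finset.Ico m m', ∫ a in D, X j a ∂P = P.real D * η := by
    intro j hj
    have hind : Indep (⨆ i ∈ {i | i < m}, MeasurableSpace.comap (X i) inferInstance)
        (⨆ i ∈ ({j} : Set ℕ), MeasurableSpace.comap (X i) inferInstance) P :=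
      indep_iSup_of_disjoint (fun i => (hX i).comap_le) hXindep (by
        rw [Set.disjoint_singleton_right]
        simpa using (Finset.mem_Ico.mp hj).1)
    rw [iSup_singleton] at hind
    rw [Indep.setIntegral_eq_mul (f := fun y => y) hle hind (hX j).aemeasurable hD
      aestronglyMeasurable_id, hmean]
  rw [Finset.sum_congr rfl hj]
  simp [Nat.cast_sub hm]
  ring

end Claims

/-! ### Mean of the increments of the counting process -/

/-- The factor `n` cancels against `n!`: past the zero term, the series is `r` times the Poisson
series with its index shifted by one. The mean comes out the same way. -/
theorem integrable_cast_poissonMeasure (r : ℝ≥0) :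
    Integrable (fun n : ℕ => (n : ℝ)) (poissonMeasure r) := by
  rw [integrable_poissonMeasure_iff, ← summable_nat_add_iff 1]
  have h := (hasSum_one_poissonMeasure r).summable.mul_left (r : ℝ)
  refine h.congr fun n => ?_
  rw [Nat.factorial_succ, Real.norm_of_nonneg (by positivity)]
  push_cast
  field_simp
  ring

theorem integral_cast_poissonMeasure (r : ℝ≥0) :
    ∫ n : ℕ, (n : ℝ) ∂(poissonMeasure r) = r := by
  have h := (hasSum_nat_add_iff' 1).mpr
    (hasSum_integral_poissonMeasure (integrable_cast_poissonMeasure r))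
  have h' := (hasSum_one_poissonMeasure r).mul_left (r : ℝ)
  have heq : (fun n : ℕ => (Real.exp (-r) * (r : ℝ) ^ (n + 1) / (n + 1).factorial) •
      ((n + 1 : ℕ) : ℝ)) = fun n : ℕ => (r : ℝ) * (Real.exp (-r) * (r : ℝ) ^ n / n.factorial) := by
    funext n
    rw [Nat.factorial_succ, smul_eq_mul]
    push_cast
    field_simp
    ring
  rw [heq] at h
  simpa using h.unique h'

theorem integrable_gcpLaw {k : ℕ} (lam : Fin k → ℝ≥0) (τ : ℝ≥0) :
    Integrable (fun n : ℕ => (n : ℝ)) (gcpLaw lam τ) := by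
  rw [gcpLaw, integrable_map_measure .of_discrete .of_discrete]
  simp only [Function.comp_def]
  push_cast
  refine integrable_finsetSum _ fun j _ => Integrable.const_mul ?_ _
  exact (measurePreserving_eval (fun j => poissonMeasure (lam j * τ)) j).integrable_comp_of_integrable
    (integrable_cast_poissonMeasure _)

theorem integral_gcpLaw {k : ℕ} (lam : Fin k → ℝ≥0) (τ : ℝ≥0) :
    ∫ n : ℕ, (n : ℝ) ∂(gcpLaw lam τ) = meanRate lam * τ := by
  rw [gcpLaw, integral_map .of_discrete .of_discrete]
  push_cast
  have hi : ∀ j : Fin k, Integrable (fun y : Fin k → ℕ => (y j : ℝ))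
      (Measure.pi fun j => poissonMeasure (lam j * τ)) := fun j =>
    (measurePreserving_eval (fun j => poissonMeasure (lam j * τ)) j).integrable_comp_of_integrable
      (integrable_cast_poissonMeasure _)
  rw [integral_finsetSum _ fun j _ => (hi j).const_mul _, meanRate]
  push_cast
  rw [Finset.sum_mul]
  refine Finset.sum_congr rfl fun j _ => ?_
  rw [integral_const_mul]
  have h2 : ∫ y : Fin k → ℕ, (y j : ℝ) ∂(Measure.pi fun j => poissonMeasure (lam j * τ)) =
      (lam j * τ : ℝ≥0) := by
    rw [← integral_cast_poissonMeasure,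
      ← (measurePreserving_eval (fun j => poissonMeasure (lam j * τ)) j).map_eq,
      integral_map .of_discrete .of_discrete]
  rw [h2]
  push_cast
  ring

/-! ### Independence of an increment from the past of the counting process -/

section Increments

variable {A : Type*} {mA : MeasurableSpace A} {P : Measure A} {N : ℝ≥0 → A → ℕ}

/-- A finite set of times up to `u` can be completed to a non-decreasing sequence which starts
at `0` and continues with `u` and `v`. -/
theorem exists_monotone_seq_of_finset {u v : ℝ≥0} (huv : u ≤ v) (I : Finset ℝ≥0)
    (hI : ∀ r ∈ I, r ≤ u) : ∃ (K : ℕ) (τ : ℕ → ℝ≥0), Monotone τ ∧ τ 0 = 0 ∧ τ K = u ∧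
      τ (K + 1) = v ∧ ∀ r ∈ I, ∃ i ≤ K, τ i = r := by
  -- Removing the largest time `a`, the induction hypothesis is used with `a` and `u` in the roles
  -- of `u` and `v`; then `v` is appended.
  induction I using Finset.induction_on_max generalizing u v with
  | empty =>
    refine ⟨1, fun i => if i = 0 then 0 else if i = 1 then u else v, ?_, by simp, by simp,
      by simp, by simp⟩
    refine monotone_nat_of_le_succ fun n => ?_
    rcases n with _ | _ | n <;> simp [huv]
  | insert a s hs ih =>
    have hau : a ≤ u := hI a (Finset.mem_insert_self _ _)
    obtain ⟨K, τ, hτ, h0, hK, hK1, hmem⟩ := ih hau (fun r hr => (hs r hr).le)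
    refine ⟨K + 1, fun i => if i ≤ K + 1 then τ i else v, ?_, by simp [h0], by simp [hK1],
      by simp, ?_⟩
    · refine monotone_nat_of_le_succ fun n => ?_
      have h1 := hτ (Nat.le_succ n)
      have h2 : n ≤ K + 1 → τ n ≤ v := fun h => (hτ h).trans (hK1.le.trans huv)
      grind
    · intro r hr
      rcases Finset.mem_insert.mp hr with rfl | hr
      · exact ⟨K, by lia, by simp [hK]⟩
      · obtain ⟨i, hi, hir⟩ := hmem r hr
        exact ⟨i, by lia, by simp [hir]; lia⟩

/-- Independence from the past reduces to finitely many past times. These embed in a monotone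
sequence starting at `0`, along which each past value is a sum of increments preceding the one over
`(u, v]`. -/
theorem indep_past_increment [IsProbabilityMeasure P] (hN : ∀ t, Measurable (N t))
    (h0 : ∀ a, N 0 a = 0) (hmono : ∀ a, Monotone fun t => N t a) (hind : HasIndepIncrements N P)
    {u v : ℝ≥0} (huv : u ≤ v) :
    Indep (⨆ q ≤ u, MeasurableSpace.comap (N q) inferInstance)
      (MeasurableSpace.comap (fun a => N v a - N u a) inferInstance) P := by
  have hsup : (⨆ q ≤ u, MeasurableSpace.comap (N q) inferInstance) =
      MeasurableSpace.comap (fun a (q : Iic u) => N q a) MeasurableSpace.pi := by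
    simp_rw [MeasurableSpace.pi, MeasurableSpace.comap_iSup, MeasurableSpace.comap_comp,
      iSup_subtype]
    rfl
  rw [hsup]
  refine IndepFun.process_indepFun (fun q => hN q) ((hN v).sub (hN u)) fun I => ?_
  obtain ⟨K, τ, hτ, hτ0, hK, hK1, hmem⟩ := exists_monotone_seq_of_finset huv
    (I.map ⟨Subtype.val, Subtype.val_injective⟩) (fun r hr => by
      obtain ⟨q, -, rfl⟩ := Finset.mem_map.mp hr
      exact q.2)
  choose! e he heq using hmem
  have hsep := (hind.nat hτ).indepFun_finset (Finset.range K) {K} (by simp)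
    (fun i => (hN _).sub (hN _))
  -- `φ` rebuilds the count at the time `τ (e i)` by telescoping, which uses `N 0 = 0`; `ψ` picks
  -- the increment from `τ K = u` to `τ (K + 1) = v`.
  have hcomp := hsep.comp
    (φ := fun (y : Finset.range K → ℕ) (i : I) =>
      ∑ j : Finset.range K, if (j : ℕ) < e i then y j else 0)
    (ψ := fun y : ({K} : Finset ℕ) → ℕ => y ⟨K, Finset.mem_singleton_self K⟩)
    .of_discrete .of_discrete
  convert hcomp using 1
  · funext a i
    have hi : ((i : Iic u) : ℝ≥0) ∈ I.map ⟨Subtype.val, Subtype.val_injective⟩ :=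
      Finset.mem_map.mpr ⟨i, i.2, rfl⟩
    have hsum : ∀ n, ∑ j ∈ Finset.range n, (N (τ (j + 1)) a - N (τ j) a) = N (τ n) a := fun n => by
      rw [Finset.sum_range_tsub (f := fun j => N (τ j) a) ((hmono a).comp hτ), hτ0, h0, Nat.sub_zero]
    simp only [Function.comp_apply]
    rw [Finset.sum_coe_sort (Finset.range K)
      (fun j => if j < e i then N (τ (j + 1)) a - N (τ j) a else 0), ← Finset.sum_filter]
    have hfil : (Finset.range K).filter (· < e i) = Finset.range (e i) := by
      ext j
      have := he _ hi
      simp; lia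
    rw [hfil, hsum, heq _ hi]
  · funext a
    simp [hK, hK1]

theorem IsNonhomogeneousGCP.integrable_sub {k : ℕ} {lam : Fin k → ℝ≥0} {Λ : ℝ≥0 → ℝ≥0}
    (hN : IsNonhomogeneousGCP lam Λ N P) {u v : ℝ≥0} (huv : u ≤ v) :
    Integrable (fun a => (N v a : ℝ) - N u a) P := by
  have h := hN.law_increment u v huv
  have h1 : Integrable (fun a => ((N v a - N u a : ℕ) : ℝ)) P :=
    (integrable_map_measure (f := fun a => N v a - N u a) .of_discrete h.aemeasurable).mp
      (h.map_eq ▸ integrable_gcpLaw lam _)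
  exact h1.congr (ae_of_all _ fun a => Nat.cast_sub (hN.mono a huv))

theorem IsNonhomogeneousGCP.integrable {k : ℕ} {lam : Fin k → ℝ≥0} {Λ : ℝ≥0 → ℝ≥0}
    (hN : IsNonhomogeneousGCP lam Λ N P) (t : ℝ≥0) : Integrable (fun a => (N t a : ℝ)) P := by
  simpa [hN.zero] using hN.integrable_sub (zero_le (a := t))

theorem meanRate_pos {k : ℕ} (hk : 1 ≤ k) {lam : Fin k → ℝ≥0} (hlam : ∀ i, 0 < lam i) :
    0 < meanRate lam :=
  Finset.sum_pos (fun i _ => mul_pos (by positivity) (hlam i)) ⟨⟨0, hk⟩, Finset.mem_univ _⟩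

theorem IsNonhomogeneousGCP.integral_sub {k : ℕ} {lam : Fin k → ℝ≥0} {Λ : ℝ≥0 → ℝ≥0}
    (hN : IsNonhomogeneousGCP lam Λ N P) (hΛ : Monotone Λ) (hlam : 0 < meanRate lam)
    {u v : ℝ≥0} (huv : u ≤ v) :
    ∫ a, ((N v a - N u a : ℕ) : ℝ) ∂P = (Λ v : ℝ) - Λ u := by
  have h := hN.law_increment u v huv
  rw [← integral_map (φ := fun a => N v a - N u a) (f := fun n : ℕ => (n : ℝ)) h.aemeasurable
    .of_discrete, h.map_eq, integral_gcpLaw, ← NNReal.coe_mul, mul_div_cancel₀ _ hlam.ne',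
    NNReal.coe_sub (hΛ huv)]

theorem IsNonhomogeneousGCP.integral_eq {k : ℕ} {lam : Fin k → ℝ≥0} {Λ : ℝ≥0 → ℝ≥0}
    (hN : IsNonhomogeneousGCP lam Λ N P) (hΛ : IsCumulativeIntensity Λ) (hlam : 0 < meanRate lam)
    (t : ℝ≥0) : ∫ a, (N t a : ℝ) ∂P = Λ t := by
  simpa [hN.zero, hΛ.zero] using hN.integral_sub hΛ.mono hlam (zero_le (a := t))

theorem IsNonhomogeneousGCP.setIntegral_sub [IsProbabilityMeasure P] {k : ℕ} {lam : Fin k → ℝ≥0}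
    {Λ : ℝ≥0 → ℝ≥0} (hN : IsNonhomogeneousGCP lam Λ N P) (hΛ : Monotone Λ)
    (hlam : 0 < meanRate lam) {u v : ℝ≥0} (huv : u ≤ v) {D : Set A}
    (hD : MeasurableSet[⨆ q ≤ u, MeasurableSpace.comap (N q) inferInstance] D) :
    ∫ a in D, ((N v a : ℝ) - N u a) ∂P = ∫ _ in D, ((Λ v : ℝ) - Λ u) ∂P := by
  have hle : (⨆ q ≤ u, MeasurableSpace.comap (N q) inferInstance) ≤ mA :=
    iSup₂_le fun q _ => (hN.measurable q).comap_le
  have hcast : ∀ a, (N v a : ℝ) - N u a = ((N v a - N u a : ℕ) : ℝ) := fun a =>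
    (Nat.cast_sub (hN.mono a huv)).symm
  simp_rw [hcast]
  rw [Indep.setIntegral_eq_mul (f := fun n : ℕ => (n : ℝ)) hle
    (indep_past_increment hN.measurable hN.zero hN.mono hN.indepIncrements huv)
    ((hN.measurable v).sub (hN.measurable u)).aemeasurable hD .of_discrete,
    hN.integral_sub hΛ hlam huv]
  simp

end Increments

/-! ### Claims, counts and time change on a product space -/

section ProductSpace

variable {A B C : Type*} {X : ℕ → A → ℝ} {N : ℝ≥0 → B → ℕ} {W : ℝ≥0 → C → ℝ≥0}

/-- The time-changed counting process on the product space. -/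
def prodCount (A : Type*) (N : ℝ≥0 → B → ℕ) (W : ℝ≥0 → C → ℝ≥0) : ℝ≥0 → A × B × C → ℕ :=
  timeChange (fun u z => N u z.2.1) (fun r z => W r z.2.2)

/-- The aggregate claims on the product space. -/
def prodClaims (X : ℕ → A → ℝ) (N : ℝ≥0 → B → ℕ) (W : ℝ≥0 → C → ℝ≥0) : ℝ≥0 → A × B × C → ℝ :=
  aggregateClaims (prodCount A N W) fun j z => X j z.1

/-- The information on the product space up to time `s`. -/
@[reducible]
def prodPast (X : ℕ → A → ℝ) (N : ℝ≥0 → B → ℕ) (W : ℝ≥0 → C → ℝ≥0) (s : ℝ≥0) :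
    MeasurableSpace (A × B × C) :=
  ((⨆ r ≤ s, MeasurableSpace.comap (prodCount A N W r) inferInstance) ⊔
    ⨆ r, MeasurableSpace.comap (fun z : A × B × C => W r z.2.2) inferInstance) ⊔
    ⨆ r ≤ s, MeasurableSpace.comap (prodClaims X N W r) inferInstance

/-- The past is a join of pulled-back σ-algebras, so measurability into it is checked on generators.
This handles sections of past events without describing the events themselves. -/
theorem measurable_prodPast_iff {E : Type*} {mE : MeasurableSpace E} {g : E → A × B × C}
    {s : ℝ≥0} : Measurable[mE, prodPast X N W s] g ↔
      ((∀ r ≤ s, Measurable[mE] fun e => prodCount A N W r (g e)) ∧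
        ∀ r, Measurable[mE] fun e => W r (g e).2.2) ∧
      ∀ r ≤ s, Measurable[mE] fun e => prodClaims X N W r (g e) := by
  simp only [measurable_iff_comap_le, prodPast, MeasurableSpace.comap_sup,
    MeasurableSpace.comap_iSup, MeasurableSpace.comap_comp, sup_le_iff, iSup_le_iff]
  rfl

/-- For fixed counts and time change, an event of the past only depends on the claims which have
already occurred. -/
theorem measurable_section_claims (s : ℝ≥0) {b : B} (hN : Monotone fun t => N t b) {c : C}
    (hW : Monotone fun r => W r c) :
    Measurable[⨆ j < N (W s c) b, MeasurableSpace.comap (X j) inferInstance, prodPast X N W s]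
      fun a : A => (a, b, c) := by
  rw [measurable_prodPast_iff]
  refine ⟨⟨fun r _ => @measurable_const _ _ _ _ (N (W r c) b),
    fun r => @measurable_const _ _ _ _ (W r c)⟩, fun r hrs => ?_⟩
  have hsum : ∀ m : MeasurableSpace A, (∀ j ∈ Finset.range (N (W r c) b), Measurable (X j)) →
      Measurable fun a => ∑ j ∈ Finset.range (N (W r c) b), X j a :=
    fun m h => Finset.measurable_fun_sum _ h
  refine hsum _ fun j hj => Measurable.of_comap_le ?_
  -- Claims counted by time `r ≤ s` have index below `N (W s c) b`, as both paths are monotone.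
  exact le_iSup₂_of_le j ((Finset.mem_range.mp hj).trans_le (hN (hW hrs))) le_rfl

/-- For fixed claims and time change, an event of the past only depends on the counts which have
already been observed. -/
theorem measurable_section_counts (s : ℝ≥0) (a : A) {c : C} (hW : Monotone fun r => W r c) :
    Measurable[⨆ q ≤ W s c, MeasurableSpace.comap (N q) inferInstance, prodPast X N W s]
      fun b : B => (a, b, c) := by
  have h : ∀ r ≤ s, Measurable[⨆ q ≤ W s c, MeasurableSpace.comap (N q) inferInstance]
      (N (W r c)) := fun r hrs => Measurable.of_comap_le <|
    le_iSup₂_of_le (W r c) (hW hrs) le_rfl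
  rw [measurable_prodPast_iff]
  refine ⟨⟨h, fun r => @measurable_const _ _ _ _ (W r c)⟩, fun r hrs => ?_⟩
  -- With the claims fixed, the aggregate is a function of the count alone.
  exact (measurable_from_nat (f := fun m => ∑ j ∈ Finset.range m, X j a)).comp (h r hrs)

variable [MeasurableSpace A] [MeasurableSpace B] [MeasurableSpace C]
  {P : Measure A} {Q : Measure B} {T : Measure C}

theorem measurable_prodCount (hN : ∀ t, Measurable (N t))
    (hr : ∀ b t, ContinuousWithinAt (fun s => N s b) (Ici t) t) (hW : ∀ r, Measurable (W r))
    (t : ℝ≥0) : Measurable (prodCount A N W t) :=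
  measurable_timeChange (N := fun u (z : A × B × C) => N u z.2.1)
    (fun u => (hN u).comp (measurable_fst.comp measurable_snd))
    (fun z t => hr z.2.1 t) (fun r => (hW r).comp (measurable_snd.comp measurable_snd)) t

theorem measurable_prodClaims (hX : ∀ j, Measurable (X j)) (hN : ∀ t, Measurable (N t))
    (hr : ∀ b t, ContinuousWithinAt (fun s => N s b) (Ici t) t) (hW : ∀ r, Measurable (W r))
    (t : ℝ≥0) : Measurable (prodClaims X N W t) :=
  measurable_aggregateClaims (measurable_prodCount hN hr hW)
    (fun j => (hX j).comp measurable_fst) t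

theorem prodPast_le (hX : ∀ j, Measurable (X j)) (hN : ∀ t, Measurable (N t))
    (hr : ∀ b t, ContinuousWithinAt (fun s => N s b) (Ici t) t) (hW : ∀ r, Measurable (W r))
    (s : ℝ≥0) : prodPast X N W s ≤ Prod.instMeasurableSpace :=
  (measurable_iff_comap_le.mp <| measurable_prodPast_iff.mpr
    ⟨⟨fun r _ => measurable_prodCount hN hr hW r,
      fun r => (hW r).comp (measurable_snd.comp measurable_snd)⟩,
      fun r _ => measurable_prodClaims hX hN hr hW r⟩).trans' (MeasurableSpace.comap_id).ge

variable [IsProbabilityMeasure P] [IsProbabilityMeasure Q] [IsProbabilityMeasure T]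
  {k : ℕ} {lam : Fin k → ℝ≥0} {Λ : ℝ≥0 → ℝ≥0}

/-- Integrating out the counting path first leaves `Λ (W t)`, integrable by assumption. -/
theorem integrable_prodCount (hN : IsNonhomogeneousGCP lam Λ N Q) (hΛ : IsCumulativeIntensity Λ)
    (hlam : 0 < meanRate lam) (hW : ∀ r, Measurable (W r))
    (hΛint : ∀ t, Integrable (fun c => (Λ (W t c) : ℝ)) T) (t : ℝ≥0) :
    Integrable (fun y : B × C => (N (W t y.2) y.1 : ℝ)) (Q.prod T) := by
  have hm : Measurable fun y : B × C => N (W t y.2) y.1 :=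
    measurable_timeChange (N := fun u (y : B × C) => N u y.1) (W := fun r y => W r y.2)
      (fun u => (hN.measurable u).comp measurable_fst) (fun y t => hN.rightCont y.1 t)
      (fun r => (hW r).comp measurable_snd) t
  have hm' : Measurable fun y : B × C => (N (W t y.2) y.1 : ℝ) := measurable_from_nat.comp hm
  rw [integrable_prod_iff' hm'.aestronglyMeasurable]
  refine ⟨ae_of_all _ fun c => hN.integrable (W t c), ?_⟩
  simpa [hN.integral_eq hΛ hlam] using hΛint t

theorem integrable_prodCount_snd (hN : IsNonhomogeneousGCP lam Λ N Q)
    (hΛ : IsCumulativeIntensity Λ) (hlam : 0 < meanRate lam) (hW : ∀ r, Measurable (W r))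
    (hΛint : ∀ t, Integrable (fun c => (Λ (W t c) : ℝ)) T) (t : ℝ≥0) :
    Integrable (fun z => (prodCount A N W t z : ℝ)) (P.prod (Q.prod T)) :=
  (integrable_prodCount hN hΛ hlam hW hΛint t).comp_snd P

/-- Integrating out the claims bounds the mean of `|C t|` by `N (W t)` times the mean of `|X 0|`. -/
theorem integrable_prodClaims (hX : ∀ j, Measurable (X j))
    (hXident : ∀ j, IdentDistrib (X j) (X 0) P P) (hXint : Integrable (X 0) P)
    (hN : IsNonhomogeneousGCP lam Λ N Q) (hΛ : IsCumulativeIntensity Λ)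
    (hlam : 0 < meanRate lam) (hW : ∀ r, Measurable (W r))
    (hΛint : ∀ t, Integrable (fun c => (Λ (W t c) : ℝ)) T) (t : ℝ≥0) :
    Integrable (prodClaims X N W t) (P.prod (Q.prod T)) := by
  have hXi : ∀ j, Integrable (X j) P := fun j => (hXident j).integrable_iff.mpr hXint
  have hmeas := (measurable_prodClaims hX hN.measurable hN.rightCont hW t).aestronglyMeasurable
    (μ := P.prod (Q.prod T))
  have hsec : ∀ y : B × C, (fun a => prodClaims X N W t (a, y)) =
      fun a => ∑ j ∈ Finset.range (N (W t y.2) y.1), X j a := fun y => rfl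
  have hsecint : ∀ y : B × C, Integrable (fun a => prodClaims X N W t (a, y)) P := fun y => by
    rw [hsec]
    exact integrable_finsetSum _ fun j _ => hXi j
  rw [integrable_prod_iff' hmeas]
  refine ⟨ae_of_all _ hsecint, ?_⟩
  refine ((integrable_prodCount hN hΛ hlam hW hΛint t).mul_const (∫ a, ‖X 0 a‖ ∂P)).mono'
    hmeas.norm.prod_swap.integral_prod_right' (ae_of_all _ fun y => ?_)
  rw [Real.norm_of_nonneg (integral_nonneg fun a => norm_nonneg _)]
  calc ∫ a, ‖prodClaims X N W t (a, y)‖ ∂P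
      ≤ ∫ a, ∑ j ∈ Finset.range (N (W t y.2) y.1), ‖X j a‖ ∂P :=
        integral_mono (hsecint y).norm (integrable_finsetSum _ fun j _ => (hXi j).norm)
          fun a => norm_sum_le (Finset.range (N (W t y.2) y.1)) fun j => X j a
    _ = (N (W t y.2) y.1 : ℝ) * ∫ a, ‖X 0 a‖ ∂P := by
        rw [integral_finsetSum _ fun j _ => (hXi j).norm,
          Finset.sum_congr rfl fun j _ => (hXident j).norm.integral_eq]
        simp

theorem setIntegral_prodClaims_sub (hX : ∀ j, Measurable (X j)) (hXindep : iIndepFun X P)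
    (hXident : ∀ j, IdentDistrib (X j) (X 0) P P) (hXint : Integrable (X 0) P) {η : ℝ}
    (hmean : ∫ a, X 0 a ∂P = η) (hN : IsNonhomogeneousGCP lam Λ N Q)
    (hΛ : IsCumulativeIntensity Λ) (hlam : 0 < meanRate lam) (hW : ∀ r, Measurable (W r))
    (hWmono : ∀ᵐ c ∂T, Monotone fun r => W r c)
    (hΛint : ∀ t, Integrable (fun c => (Λ (W t c) : ℝ)) T) {s t : ℝ≥0} (hst : s ≤ t)
    {D : Set (A × B × C)} (hD : MeasurableSet[prodPast X N W s] D) :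
    ∫ z in D, (prodClaims X N W t z - prodClaims X N W s z) ∂(P.prod (Q.prod T)) =
      ∫ z in D, η * ((Λ (W t z.2.2) : ℝ) - Λ (W s z.2.2)) ∂(P.prod (Q.prod T)) := by
  have hCint := integrable_prodClaims hX hXident hXint hN hΛ hlam hW hΛint
  have hNint := integrable_prodCount hN hΛ hlam hW hΛint
  have hNint' := integrable_prodCount_snd (A := A) (P := P) hN hΛ hlam hW hΛint
  have hΛint2 : ∀ t, Integrable (fun y : B × C => (Λ (W t y.2) : ℝ)) (Q.prod T) :=
    fun t => (hΛint t).comp_snd Q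
  have hΛint3 : ∀ t, Integrable (fun z : A × B × C => (Λ (W t z.2.2) : ℝ)) (P.prod (Q.prod T)) :=
    fun t => (hΛint2 t).comp_snd P
  have hDm := prodPast_le hX hN.measurable hN.rightCont hW s D hD
  -- Freeze counts and time change: each claim after time `s` is replaced by its mean.
  have hcounts : ∫ z in D, (prodClaims X N W t z - prodClaims X N W s z) ∂(P.prod (Q.prod T)) =
      ∫ z in D, η * ((prodCount A N W t z : ℝ) - prodCount A N W s z) ∂(P.prod (Q.prod T)) := by
    refine setIntegral_prod_congr_of_sections' ((hCint t).sub (hCint s))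
      (((hNint' t).sub (hNint' s)).const_mul η) hDm ?_
    have hmono' : ∀ᵐ y ∂(Q.prod T), Monotone fun r => W r y.2 :=
      Measure.quasiMeasurePreserving_snd.ae hWmono
    filter_upwards [hmono'] with y hy
    exact setIntegral_sum_range_sub hX hXindep (fun j => (hXident j).integrable_iff.mpr hXint)
      (fun j => (hXident j).integral_eq.trans hmean) (hN.mono y.1 (hy hst))
      (measurable_section_claims s (hN.mono y.1) hy hD)
  rw [hcounts]
  -- Freeze claims and time change: the count increment is replaced by its mean.
  refine setIntegral_prod_congr_of_sections (((hNint' t).sub (hNint' s)).const_mul η)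
    (((hΛint3 t).sub (hΛint3 s)).const_mul η) hDm (ae_of_all _ fun a => ?_)
  refine setIntegral_prod_congr_of_sections' (((hNint t).sub (hNint s)).const_mul η)
    (((hΛint2 t).sub (hΛint2 s)).const_mul η) (measurable_prodMk_left hDm) ?_
  filter_upwards [hWmono] with c hc
  rw [integral_const_mul, integral_const_mul]
  congr 1
  exact hN.setIntegral_sub hΛ.mono hlam (hc hst) (measurable_section_counts s a hc hD)

end ProductSpace

/-! ### Monotonicity of the first-passage process -/

section Inverse

variable {Ω : Type*} {mΩ : MeasurableSpace Ω} {μ : Measure Ω}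

/-- Markov's inequality for `exp (-S n)`, whose mean is `exp (-n)`, gives `P(S n ≤ c) ≤ exp (c -
n)`; let `n` tend to infinity. -/
theorem IsStableSubordinator.ae_unbounded [IsProbabilityMeasure μ] {β : ℝ} {S : ℝ≥0 → Ω → ℝ}
    (hS : IsStableSubordinator β S μ) : ∀ᵐ ω ∂μ, ∀ c : ℕ, ∃ n : ℕ, (c : ℝ) < S n ω := by
  refine ae_all_iff.mpr fun c => ?_
  have hset : {ω | ¬ ∃ n : ℕ, (c : ℝ) < S n ω} = ⋂ n : ℕ, {ω | S n ω ≤ c} := by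
    ext ω
    simp
  have hnn : ∀ (n : ℕ) ω, 0 ≤ S n ω := fun n ω =>
    (hS.zero ω).symm.le.trans (hS.mono ω (zero_le (a := (n : ℝ≥0))))
  have hbound : ∀ n : ℕ, Real.exp (-c) * μ.real {ω | ¬ ∃ n : ℕ, (c : ℝ) < S n ω} ≤
      Real.exp (-n) := by
    intro n
    have hmeas : Measurable fun ω => Real.exp (-1 * S n ω) :=
      Real.measurable_exp.comp ((hS.measurable n).const_mul _)
    have hint : Integrable (fun ω => Real.exp (-1 * S n ω)) μ :=
      Integrable.of_bound hmeas.aestronglyMeasurable 1 (ae_of_all _ fun ω => by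
        rw [Real.norm_of_nonneg (Real.exp_pos _).le, Real.exp_le_one_iff]
        linarith [hnn n ω])
    have hmarkov := mul_meas_ge_le_integral_of_nonneg
      (ae_of_all μ fun ω => (Real.exp_pos (-1 * S n ω)).le) hint (Real.exp (-c))
    have hlap := hS.laplace n 1 one_pos
    rw [Real.one_rpow, mul_one] at hlap
    rw [hlap] at hmarkov
    refine (mul_le_mul_of_nonneg_left (measureReal_mono fun ω hω => ?_)
      (Real.exp_pos _).le).trans hmarkov
    rw [hset] at hω
    have := mem_iInter.mp hω n
    simp only [mem_ofPred_eq] at this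
    simp only [mem_ofPred_eq, Real.exp_le_exp]
    linarith
  have hlim : Tendsto (fun n : ℕ => Real.exp (-(n : ℝ))) atTop (𝓝 0) :=
    Real.tendsto_exp_neg_atTop_nhds_zero.comp tendsto_natCast_atTop_atTop
  have hle := ge_of_tendsto' hlim hbound
  have hz : μ.real {ω | ¬ ∃ n : ℕ, (c : ℝ) < S n ω} = 0 :=
    le_antisymm (nonpos_of_mul_nonpos_right hle (Real.exp_pos _)) measureReal_nonneg
  exact (measureReal_eq_zero_iff).mp hz

/-- Raising the level shrinks the set of passage times. Unboundedness keeps that set nonempty, so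
its infimum does not drop to the default value `0`. -/
theorem monotone_inverse_of_unbounded {S : ℝ≥0 → Ω → ℝ} {ω : Ω}
    (h : ∀ c : ℕ, ∃ r, (c : ℝ) < S r ω) : Monotone fun t => inverse S t ω := by
  intro s t hst
  obtain ⟨c, hc⟩ := exists_nat_ge (t : ℝ)
  obtain ⟨r, hr⟩ := h c
  exact csInf_le_csInf (OrderBot.bddBelow _) ⟨r, hc.trans_lt hr⟩
    fun q hq => lt_of_le_of_lt (NNReal.coe_le_coe.mpr hst) hq

/-- With the converse below, this reads the unboundedness of `S` off the values of its inverse at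
integer levels, that is, off countably many coordinates. -/
theorem unbounded_of_not_eventually_inverse_eq_zero {S : ℝ≥0 → Ω → ℝ} {ω : Ω}
    (h : ¬ ∃ n : ℕ, ∀ m : ℕ, n ≤ m → inverse S m ω = 0) (c : ℕ) : ∃ r, (c : ℝ) < S r ω := by
  by_contra! hc
  refine h ⟨c, fun m hm => ?_⟩
  have hempty : {r : ℝ≥0 | ((m : ℝ≥0) : ℝ) < S r ω} = ∅ := by
    refine eq_empty_of_forall_notMem fun r hr => absurd hr (not_lt.mpr ((hc r).trans ?_))
    exact_mod_cast hm
  rw [inverse, hempty, NNReal.sInf_empty]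

theorem not_eventually_inverse_eq_zero {S : ℝ≥0 → Ω → ℝ} {ω : Ω}
    (hmono : Monotone fun r => S r ω) (h : ∀ c : ℕ, ∃ r, (c : ℝ) < S r ω) :
    ¬ ∃ n : ℕ, ∀ m : ℕ, n ≤ m → inverse S m ω = 0 := by
  rintro ⟨n, hn⟩
  -- A level at or above `S 1` cannot be exceeded before time `1`, so its passage time is at least
  -- `1`.
  obtain ⟨c, hc⟩ := exists_nat_ge (S 1 ω)
  obtain ⟨r, hr⟩ := h (max n c)
  have hle : (1 : ℝ≥0) ≤ inverse S (max n c : ℕ) ω := by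
    refine le_csInf ⟨r, by simpa using hr⟩ fun q hq => ?_
    by_contra! hq1
    have h1 : S q ω ≤ c := (hmono hq1.le).trans hc
    have h2 : ((max n c : ℕ) : ℝ) < S q ω := by simpa using hq
    have h3 : (c : ℝ) ≤ (max n c : ℕ) := by exact_mod_cast le_max_right n c
    linarith
  rw [hn _ (le_max_left n c)] at hle
  exact absurd hle (by simp)

end Inverse

/-! ### Transfer to the product of the path spaces -/

section Transfer

variable {Ω E : Type*} {mΩ : MeasurableSpace Ω} {mE : MeasurableSpace E} {μ : Measure Ω}
  [IsProbabilityMeasure μ]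

theorem iIndepFun_map {ι F : Type*} [MeasurableSpace F] {g : Ω → E} (hg : Measurable g)
    {Y : ι → E → F} (hY : ∀ i, Measurable (Y i)) (h : iIndepFun (fun i ω => Y i (g ω)) μ) :
    iIndepFun Y (μ.map g) := by
  have := Measure.isProbabilityMeasure_map (μ := μ) hg.aemeasurable
  rw [iIndepFun_iff_map_fun_eq_infinitePi_map hY, Measure.map_map (measurable_pi_lambda _ hY) hg]
  have h2 := h.map_fun_eq_infinitePi_map fun i => (hY i).comp hg
  simp_rw [Measure.map_map (hY _) hg]
  exact h2

/-- Path properties are required at every point, not almost everywhere, so surjectivity of `g` is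
what carries them over. -/
theorem IsNonhomogeneousGCP.map {k : ℕ} {lam : Fin k → ℝ≥0} {Λ : ℝ≥0 → ℝ≥0}
    {g : Ω → E} (hg : Measurable g) (hgs : Function.Surjective g) {N : ℝ≥0 → E → ℕ}
    (hNm : ∀ t, Measurable (N t)) (hN : IsNonhomogeneousGCP lam Λ (fun t ω => N t (g ω)) μ) :
    IsNonhomogeneousGCP lam Λ N (μ.map g) where
  measurable := hNm
  zero := hgs.forall.mpr hN.zero
  mono := hgs.forall.mpr hN.mono
  rightCont := hgs.forall.mpr hN.rightCont
  indepIncrements n t ht :=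
    iIndepFun_map hg (fun _ => (hNm _).sub (hNm _)) (hN.indepIncrements n t ht)
  law_increment s t hst := by
    have h := hN.law_increment s t hst
    have hm : Measurable fun e => N t e - N s e := (hNm t).sub (hNm s)
    refine ⟨hm.aemeasurable, ?_⟩
    rw [Measure.map_map hm hg]
    exact h.map_eq

theorem comap_rangeFactorization (f : Ω → E) :
    MeasurableSpace.comap (rangeFactorization f) inferInstance = MeasurableSpace.comap f mE := by
  change MeasurableSpace.comap _ (MeasurableSpace.comap _ _) = _
  rw [MeasurableSpace.comap_comp]
  rfl

variable {S : ℝ≥0 → Ω → ℝ} {N : ℝ≥0 → Ω → ℕ} {X : ℕ → Ω → ℝ}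

/-- The map which sends an outcome to its claims and its counting and first-passage paths. -/
def pathMap (X : ℕ → Ω → ℝ) (N : ℝ≥0 → Ω → ℕ) (W : ℝ≥0 → Ω → ℝ≥0) (ω : Ω) :
    (ℕ → ℝ) × range (fun ω t => N t ω) × range (fun ω t => W t ω) :=
  (fun j => X j ω, rangeFactorization (fun ω t => N t ω) ω,
    rangeFactorization (fun ω t => W t ω) ω)

/-- Using ranges instead of full function spaces keeps every counting path monotone and
right-continuous. The generated σ-algebras are unchanged, so independence still makes the joint law
a product. -/
theorem map_pathMap {W : ℝ≥0 → Ω → ℝ≥0} (hX : ∀ j, Measurable (X j)) (hN : ∀ t, Measurable (N t))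
    (hW : ∀ t, Measurable (W t)) (hNW : IndepFun (fun ω t => N t ω) (fun ω t => W t ω) μ)
    (hXNW : IndepFun (fun ω j => X j ω) (fun ω => ((fun t => N t ω), (fun t => W t ω))) μ) :
    μ.map (pathMap X N W) = (μ.map fun ω j => X j ω).prod
      ((μ.map (rangeFactorization fun ω t => N t ω)).prod
        (μ.map (rangeFactorization fun ω t => W t ω))) := by
  have hXm : Measurable fun ω j => X j ω := measurable_pi_lambda _ hX
  have hNm : Measurable (rangeFactorization fun ω t => N t ω) :=
    (measurable_pi_lambda _ hN).subtype_mk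
  have hWm : Measurable (rangeFactorization fun ω t => W t ω) :=
    (measurable_pi_lambda _ hW).subtype_mk
  have h1 : IndepFun (rangeFactorization fun ω t => N t ω)
      (rangeFactorization fun ω t => W t ω) μ := by
    rw [IndepFun_iff_Indep] at hNW ⊢
    rwa [comap_rangeFactorization, comap_rangeFactorization]
  have h2 : IndepFun (fun ω j => X j ω) (fun ω => (rangeFactorization (fun ω t => N t ω) ω,
      rangeFactorization (fun ω t => W t ω) ω)) μ := by
    rw [IndepFun_iff_Indep] at hXNW ⊢
    change Indep _ (MeasurableSpace.comap _ (MeasurableSpace.prod _ _)) _ at hXNW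
    change Indep _ (MeasurableSpace.comap _ (MeasurableSpace.prod _ _)) _
    rw [MeasurableSpace.comap_prodMk] at hXNW ⊢
    rwa [comap_rangeFactorization, comap_rangeFactorization]
  rw [← (indepFun_iff_map_prod_eq_prod_map_map hNm.aemeasurable hWm.aemeasurable).mp h1,
    ← (indepFun_iff_map_prod_eq_prod_map_map hXm.aemeasurable (hNm.prodMk hWm).aemeasurable).mp h2]
  rfl

/-- Monotonicity involves uncountably many coordinates. It is deduced from a measurable event on
integer coordinates, "not eventually zero", which has full measure. -/
theorem ae_monotone_range_inverse {β : ℝ} (hS : IsStableSubordinator β S μ) :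
    ∀ᵐ w : range (fun ω t => inverse S t ω) ∂(μ.map (rangeFactorization fun ω t => inverse S t ω)),
      Monotone (w : ℝ≥0 → ℝ≥0) := by
  have hm : Measurable (rangeFactorization fun ω t => inverse S t ω) :=
    (measurable_pi_lambda _ hS.measurable_inverse).subtype_mk
  have hset : MeasurableSet {w : range fun ω t => inverse S t ω |
      ¬ ∃ n : ℕ, ∀ m : ℕ, n ≤ m → (w : ℝ≥0 → ℝ≥0) m = 0} := by
    have heval : ∀ m : ℕ, Measurable fun w : range fun ω t => inverse S t ω =>
        (w : ℝ≥0 → ℝ≥0) m := fun m => (measurable_pi_apply _).comp measurable_subtype_coe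
    refine measurableSet_setOfPred.mpr (Measurable.not (Measurable.exists fun n =>
      Measurable.forall fun m => Measurable.imp measurable_const ?_))
    exact measurableSet_setOfPred.mp (heval m (measurableSet_singleton 0))
  have hae := (ae_map_iff hm.aemeasurable hset).mpr (hS.ae_unbounded.mono fun ω hω =>
    not_eventually_inverse_eq_zero (hS.mono ω) fun c => (hω c).imp' _ fun _ h => h)
  filter_upwards [hae]
  rintro ⟨_, ω, rfl⟩ hw
  exact monotone_inverse_of_unbounded (unbounded_of_not_eventually_inverse_eq_zero hw)

end Transfer

/-! ### Conditional increments of the aggregate claims and of the risk process -/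

section Claims

variable {Ω : Type*} {mΩ : MeasurableSpace Ω} {μ : Measure Ω} [IsProbabilityMeasure μ]
  {β : ℝ} {S : ℝ≥0 → Ω → ℝ} {k : ℕ} {lam : Fin k → ℝ≥0} {Λ : ℝ≥0 → ℝ≥0} {N : ℝ≥0 → Ω → ℕ}
  {X : ℕ → Ω → ℝ} {η : ℝ}

theorem integrable_and_setIntegral_aggregateClaims_sub (hS : IsStableSubordinator β S μ)
    (hΛ : IsCumulativeIntensity Λ) (hlam : 0 < meanRate lam)
    (hN : IsNonhomogeneousGCP lam Λ N μ) (hX : ∀ j, Measurable (X j)) (hXindep : iIndepFun X μ)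
    (hXident : ∀ j, IdentDistrib (X j) (X 0) μ μ) (hXint : Integrable (X 0) μ)
    (hmean : ∫ ω, X 0 ω ∂μ = η)
    (hNW : IndepFun (fun ω t => N t ω) (fun ω t => inverse S t ω) μ)
    (hXNW : IndepFun (fun ω j => X j ω)
      (fun ω => ((fun t => N t ω), (fun t => inverse S t ω))) μ)
    (hΛint : ∀ t, Integrable (fun ω => (Λ (inverse S t ω) : ℝ)) μ) :
    (∀ t, Integrable (aggregateClaims (timeChange N (inverse S)) X t) μ) ∧
    ∀ s t, s ≤ t → ∀ D,
      MeasurableSet[enlarge (timeChangedFiltration (timeChange N (inverse S)) (inverse S)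
        (hN.measurable_timeChange hS.measurable_inverse) hS.measurable_inverse)
        (aggregateClaims (timeChange N (inverse S)) X)
        (measurable_aggregateClaims (hN.measurable_timeChange hS.measurable_inverse) hX) s] D →
      ∫ ω in D, (aggregateClaims (timeChange N (inverse S)) X t ω -
          aggregateClaims (timeChange N (inverse S)) X s ω) ∂μ =
        ∫ ω in D, η * ((Λ (inverse S t ω) : ℝ) - Λ (inverse S s ω)) ∂μ := by
  have hXm : Measurable fun ω j => X j ω := measurable_pi_lambda _ hX
  have hNm : Measurable (rangeFactorization fun ω t => N t ω) :=
    (measurable_pi_lambda _ hN.measurable).subtype_mk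
  have hWm : Measurable (rangeFactorization fun ω t => inverse S t ω) :=
    (measurable_pi_lambda _ hS.measurable_inverse).subtype_mk
  have hΦm : Measurable (pathMap X N (inverse S)) := hXm.prodMk (hNm.prodMk hWm)
  have := Measure.isProbabilityMeasure_map (μ := μ) hXm.aemeasurable
  have := Measure.isProbabilityMeasure_map (μ := μ) hNm.aemeasurable
  have := Measure.isProbabilityMeasure_map (μ := μ) hWm.aemeasurable
  have hlaw := map_pathMap hX hN.measurable hS.measurable_inverse hNW hXNW
  -- the coordinate processes
  let x : ℕ → (ℕ → ℝ) → ℝ := fun j y => y j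
  let n : ℝ≥0 → range (fun ω t => N t ω) → ℕ := fun u p => (p : ℝ≥0 → ℕ) u
  let w : ℝ≥0 → range (fun ω t => inverse S t ω) → ℝ≥0 := fun r q => (q : ℝ≥0 → ℝ≥0) r
  have hxm : ∀ j, Measurable (x j) := measurable_pi_apply
  have hnm : ∀ u, Measurable (n u) := fun u => (measurable_pi_apply u).comp measurable_subtype_coe
  have hwm : ∀ r, Measurable (w r) := fun r => (measurable_pi_apply r).comp measurable_subtype_coe
  have hxindep : iIndepFun x (μ.map fun ω j => X j ω) := iIndepFun_map hXm hxm hXindep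
  have hxident : ∀ j, IdentDistrib (x j) (x 0) (μ.map fun ω j => X j ω)
      (μ.map fun ω j => X j ω) := fun j => by
    refine ⟨(hxm j).aemeasurable, (hxm 0).aemeasurable, ?_⟩
    rw [Measure.map_map (hxm j) hXm, Measure.map_map (hxm 0) hXm]
    exact (hXident j).map_eq
  have hxint : Integrable (x 0) (μ.map fun ω j => X j ω) :=
    (integrable_map_measure (hxm 0).aestronglyMeasurable hXm.aemeasurable).mpr hXint
  have hxmean : ∫ y, x 0 y ∂(μ.map fun ω j => X j ω) = η := by
    rw [integral_map hXm.aemeasurable (hxm 0).aestronglyMeasurable]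
    exact hmean
  have hn : IsNonhomogeneousGCP lam Λ n (μ.map (rangeFactorization fun ω t => N t ω)) :=
    IsNonhomogeneousGCP.map hNm rangeFactorization_surjective hnm hN
  have hΛm : Measurable fun u => (Λ u : ℝ) := measurable_coe_nnreal_real.comp hΛ.mono.measurable
  have hwint : ∀ t, Integrable (fun q => (Λ (w t q) : ℝ))
      (μ.map (rangeFactorization fun ω t => inverse S t ω)) := fun t =>
    (integrable_map_measure (hΛm.comp (hwm t)).aestronglyMeasurable hWm.aemeasurable).mpr (hΛint t)
  have hCm := measurable_prodClaims hxm hn.measurable hn.rightCont hwm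
  refine ⟨fun t => ?_, fun s t hst D hD => ?_⟩
  · have h := integrable_prodClaims hxm hxident hxint hn hΛ hlam hwm hwint t
    rw [← hlaw] at h
    exact (integrable_map_measure (hCm t).aestronglyMeasurable hΦm.aemeasurable).mp h
  -- `G s` is the pullback of the product-space past under the path map, so each of its events is a
  -- preimage.
  · have hpast : enlarge (timeChangedFiltration (timeChange N (inverse S)) (inverse S)
        (hN.measurable_timeChange hS.measurable_inverse) hS.measurable_inverse)
        (aggregateClaims (timeChange N (inverse S)) X)
        (measurable_aggregateClaims (hN.measurable_timeChange hS.measurable_inverse) hX) s =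
        MeasurableSpace.comap (pathMap X N (inverse S)) (prodPast x n w s) := by
      simp only [prodPast, MeasurableSpace.comap_sup, MeasurableSpace.comap_iSup,
        MeasurableSpace.comap_comp]
      rfl
    rw [hpast] at hD
    obtain ⟨D', hD', rfl⟩ := hD
    have hD'm := prodPast_le hxm hn.measurable hn.rightCont hwm s D' hD'
    have h := setIntegral_prodClaims_sub hxm hxindep hxident hxint hxmean hn hΛ hlam hwm
      (ae_monotone_range_inverse hS) hwint hst hD'
    have hwm' : ∀ r, Measurable fun z : (ℕ → ℝ) × range (fun ω t => N t ω) ×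
        range (fun ω t => inverse S t ω) => (Λ (w r z.2.2) : ℝ) := fun r =>
      hΛm.comp ((hwm r).comp (measurable_snd.comp measurable_snd))
    have hCst : Measurable fun z => prodClaims x n w t z - prodClaims x n w s z :=
      (hCm t).sub (hCm s)
    have hwst : Measurable fun z : (ℕ → ℝ) × range (fun ω t => N t ω) ×
        range (fun ω t => inverse S t ω) => η * ((Λ (w t z.2.2) : ℝ) - Λ (w s z.2.2)) :=
      ((hwm' t).sub (hwm' s)).const_mul η
    rw [← hlaw, setIntegral_map hD'm hCst.aestronglyMeasurable hΦm.aemeasurable,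
      setIntegral_map hD'm hwst.aestronglyMeasurable hΦm.aemeasurable] at h
    exact h

/-- If the claims increments have conditional mean `η (L t - L s)` and `L` is known, then the
conditional mean of the increments of `ν + η (1 + ρ) L - C` is `η ρ (L t - L s)`. -/
theorem condExp_sub_ae_eq {C L R : ℝ≥0 → Ω → ℝ} {ν ρ : ℝ} {s t : ℝ≥0} {m : MeasurableSpace Ω}
    (hm : m ≤ mΩ) (hR : ∀ t ω, R t ω = ν + η * (1 + ρ) * L t ω - C t ω)
    (hC : ∀ t, Integrable (C t) μ) (hL : ∀ t, Integrable (L t) μ) (hLm : ∀ t, Measurable[m] (L t))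
    (h : ∀ D, MeasurableSet[m] D →
      ∫ ω in D, (C t ω - C s ω) ∂μ = ∫ ω in D, η * (L t ω - L s ω) ∂μ) :
    μ[R t - R s | m] =ᵐ[μ] fun ω => η * ρ * (L t ω - L s ω) := by
  have hRint : Integrable (R t - R s) μ := by
    have hR' : ∀ t, Integrable (R t) μ := fun t => by
      rw [funext (hR t)]
      exact ((integrable_const ν).add ((hL t).const_mul _)).sub (hC t)
    exact (hR' t).sub (hR' s)
  have hLint : Integrable (fun ω => L t ω - L s ω) μ := (hL t).sub (hL s)
  have hCint : Integrable (fun ω => C t ω - C s ω) μ := (hC t).sub (hC s)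
  refine (ae_eq_condExp_of_forall_setIntegral_eq hm hRint
    (fun D _ _ => (hLint.const_mul _).integrableOn) (fun D hD _ => ?_) ?_).symm
  · have hRs : ∀ ω, (R t - R s) ω =
        η * (1 + ρ) * (L t ω - L s ω) - (C t ω - C s ω) := fun ω => by
      rw [Pi.sub_apply, hR, hR]
      ring
    simp_rw [hRs]
    rw [integral_sub (hLint.const_mul _).integrableOn hCint.integrableOn, h D hD,
      integral_const_mul, integral_const_mul, integral_const_mul]
    ring
  · exact (((hLm t).sub (hLm s)).const_mul (η * ρ)).aestronglyMeasurable

end Claims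

end RiskProcess

/-! ### Sign of the conditional drift -/

theorem mainTheorem9
    {Ω : Type*} {mΩ : MeasurableSpace Ω} (μ : Measure Ω) [IsProbabilityMeasure μ]
    -- the inverse stable subordinator `W`
    (β : ℝ) (hβ : β ∈ Set.Ioo (0 : ℝ) 1)
    (S : ℝ≥0 → Ω → ℝ) (hS : RiskProcess.IsStableSubordinator β S μ)
    -- the non-homogeneous generalized counting process `N`
    (k : ℕ) (hk : 1 ≤ k) (lam : Fin k → ℝ≥0) (hlam : ∀ i, 0 < lam i)
    (Λ : ℝ≥0 → ℝ≥0) (hΛ : RiskProcess.IsCumulativeIntensity Λ)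
    (N : ℝ≥0 → Ω → ℕ) (hN : RiskProcess.IsNonhomogeneousGCP lam Λ N μ)
    -- the i.i.d. claims with mean `η`
    (X : ℕ → Ω → ℝ) (hX : ∀ j, Measurable (X j)) (hXindep : iIndepFun X μ)
    (hXident : ∀ j, IdentDistrib (X j) (X 0) μ μ) (hXint : Integrable (X 0) μ)
    (η : ℝ) (hη : 0 < η) (hmean : ∫ ω, X 0 ω ∂μ = η)
    -- the claims, the counting process and the time change are mutually independent
    (hNW : IndepFun (fun ω t => N t ω) (fun ω t => RiskProcess.inverse S t ω) μ)
    (hXNW : IndepFun (fun ω j => X j ω)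
      (fun ω => ((fun t => N t ω), (fun t => RiskProcess.inverse S t ω))) μ)
    -- the premium has finite mean
    (hΛint : ∀ t, Integrable (fun ω => (Λ (RiskProcess.inverse S t ω) : ℝ)) μ)
    (ν : ℝ) (hν : 0 < ν) (ρ : ℝ) :
    let W : ℝ≥0 → Ω → ℝ≥0 := RiskProcess.inverse S
    let M : ℝ≥0 → Ω → ℕ := RiskProcess.timeChange N W
    let R : ℝ≥0 → Ω → ℝ := RiskProcess.riskProcess ν η ρ Λ N W X
    let F : Filtration ℝ≥0 mΩ := RiskProcess.timeChangedFiltration M W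
      (hN.measurable_timeChange hS.measurable_inverse) hS.measurable_inverse
    let G : Filtration ℝ≥0 mΩ := RiskProcess.enlarge F (RiskProcess.aggregateClaims M X)
      (RiskProcess.measurable_aggregateClaims
        (hN.measurable_timeChange hS.measurable_inverse) hX)
    (ρ = 0 → Martingale R G μ ∧ ∀ s t, s ≤ t → μ[R t - R s | F s] =ᵐ[μ] 0) ∧
    (0 < ρ → Submartingale R G μ ∧ ∀ s t, s ≤ t → 0 ≤ᵐ[μ] μ[R t - R s | F s]) ∧
    (ρ < 0 → Supermartingale R G μ ∧ ∀ s t, s ≤ t → μ[R t - R s | F s] ≤ᵐ[μ] 0) := by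
  intro W M R F G
  have hlam' := RiskProcess.meanRate_pos hk hlam
  obtain ⟨hCint, hCset⟩ := RiskProcess.integrable_and_setIntegral_aggregateClaims_sub hS hΛ hlam' hN
    hX hXindep hXident hXint hmean hNW hXNW hΛint
  -- No relation between `s` and `t` is needed: `F s` contains the entire path of `W`.
  have hWF : ∀ s t, Measurable[F s] (W t) := fun s t =>
    Measurable.of_comap_le ((le_iSup (fun r => MeasurableSpace.comap (W r) inferInstance) t).trans
      le_sup_right)
  have hFG : ∀ s, F s ≤ G s := fun s => le_sup_left
  have hLF : ∀ s t, Measurable[F s] fun ω => (Λ (W t ω) : ℝ) := fun s t =>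
    (measurable_coe_nnreal_real.comp hΛ.mono.measurable).comp (hWF s t)
  have hLG : ∀ s t, Measurable[G s] fun ω => (Λ (W t ω) : ℝ) := fun s t =>
    (hLF s t).mono (hFG s) le_rfl
  have hCG : ∀ s, Measurable[G s] (RiskProcess.aggregateClaims M X s) := fun s =>
    Measurable.of_comap_le ((le_iSup₂ (f := fun r (_ : r ≤ s) =>
      MeasurableSpace.comap (RiskProcess.aggregateClaims M X r) inferInstance) s le_rfl).trans
      le_sup_right)
  have hRint : ∀ t, Integrable (R t) μ := fun t =>
    ((integrable_const ν).add ((hΛint t).const_mul (η * (1 + ρ)))).sub (hCint t)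
  have hadapted : StronglyAdapted G R := fun t =>
    (((hLG t t).const_mul (η * (1 + ρ))).const_add ν |>.sub (hCG t)).stronglyMeasurable
  have hG : ∀ s t, s ≤ t → μ[R t - R s | G s] =ᵐ[μ]
      fun ω => η * ρ * ((Λ (W t ω) : ℝ) - Λ (W s ω)) := fun s t hst =>
    RiskProcess.condExp_sub_ae_eq (R := R)
      (C := RiskProcess.aggregateClaims M X) (L := fun t ω => (Λ (W t ω) : ℝ)) (G.le s) (fun _ _ => rfl) hCint hΛint (hLG s) (hCset s t hst)
  -- Although `R` need not be adapted to `F`, its increment has a conditional mean measurable for `F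
  -- s`.
  have hF : ∀ s t, s ≤ t → μ[R t - R s | F s] =ᵐ[μ]
      fun ω => η * ρ * ((Λ (W t ω) : ℝ) - Λ (W s ω)) := fun s t hst =>
    RiskProcess.condExp_sub_ae_eq (R := R)
      (C := RiskProcess.aggregateClaims M X) (L := fun t ω => (Λ (W t ω) : ℝ)) (F.le s) (fun _ _ => rfl) hCint hΛint (hLF s)
      fun D hD => hCset s t hst D (hFG s D hD)
  have hmono : ∀ s t, s ≤ t → ∀ᵐ ω ∂μ, 0 ≤ (Λ (W t ω) : ℝ) - Λ (W s ω) := fun s t hst => by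
    filter_upwards [hS.ae_unbounded] with ω hω
    have hW := RiskProcess.monotone_inverse_of_unbounded fun c => (hω c).imp' _ fun _ h => h
    exact sub_nonneg.mpr (NNReal.coe_le_coe.mpr (hΛ.mono (hW hst)))
  have hself : ∀ s t, μ[R t | G s] =ᵐ[μ] μ[R t - R s | G s] + R s := fun s t => by
    have h := condExp_add ((hRint t).sub (hRint s)) (hRint s) (G s)
    rwa [sub_add_cancel, condExp_of_stronglyMeasurable (G.le s) (hadapted s) (hRint s)] at h
  refine ⟨fun hρ => ?_, fun hρ => ?_, fun hρ => ?_⟩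
  · refine ⟨⟨hadapted, fun s t hst => ?_⟩, fun s t hst => ?_⟩
    · filter_upwards [hself s t, hG s t hst] with ω h1 h2
      simp [h1, h2, hρ]
    · filter_upwards [hF s t hst] with ω h
      simp [h, hρ]
  · refine ⟨⟨hadapted, fun s t hst => ?_, hRint⟩, fun s t hst => ?_⟩
    · filter_upwards [hself s t, hG s t hst, hmono s t hst] with ω h1 h2 h3
      rw [h1, Pi.add_apply, h2]
      exact le_add_of_nonneg_left (mul_nonneg (mul_pos hη hρ).le h3)
    · filter_upwards [hF s t hst, hmono s t hst] with ω h h3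
      rw [h]
      exact mul_nonneg (mul_pos hη hρ).le h3
  · refine ⟨⟨hadapted, fun s t hst => ?_, hRint⟩, fun s t hst => ?_⟩
    · filter_upwards [hself s t, hG s t hst, hmono s t hst] with ω h1 h2 h3
      rw [h1, Pi.add_apply, h2]
      exact add_le_of_nonpos_left
        (mul_nonpos_of_nonpos_of_nonneg (mul_neg_of_pos_of_neg hη hρ).le h3)
    · filter_upwards [hF s t hst, hmono s t hst] with ω h h3
      rw [h]
      exact mul_nonpos_of_nonpos_of_nonneg (mul_neg_of_pos_of_neg hη hρ).le h3
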